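/- Let $n\ge 3$ be an integer, let $\zeta_{2^n}$ be a primitive $2^n$-th root of unity, and let $K_n=\mathbb{Q}(\zeta_{2^n})$. Let $p$ be a prime number with $p\equiv 9\pmod{16}$ and let $\mathfrak p$ be a prime ideal of the ring of integers of $K_n$ dividing $p$. For $\alpha,\beta\in K_n^{\times}$ let $\left(\frac{\alpha,\beta}{\mathfrak p}\right)\in\{1,-1\}$ denote the quadratic norm residue symbol: with $K_{n,\mathfrak p}$ the completion of $K_n$ at $\mathfrak p$, it equals $1$ if $\alpha$ is a norm from $K_{n,\mathfrak p}(\sqrt{\beta})$ to $K_{n,\mathfrak p}$, and $-1$ otherwise. Let $\left(\frac{2}{p}\right)_4$ be the rational biquadratic residue symbol, equal to $1$ if $2$ is a fourth power modulo $p$ and to $-1$ otherwise. For an odd integer $k$ with $1<k<2^{n-1}$, let $$\xi_{k,n}=\zeta_{2^n}^{(1-k)/2}\,\frac{1-\zeta_{2^n}^{k}}{1-\zeta_{2^n}}.$$ Then $$\left(\frac{\zeta_{2^n},p}{\mathfrak p}\right)=-1,$$ and for every odd integer $k$ with $1<k<2^{n-1}$, $$\left(\frac{\xi_{k,n},p}{\mathfrak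 p}\right)=\begin{cases}-\left(\frac{2}{p}\right)_4, & \text{if } k\equiv\pm 3\pmod 8,\\[2pt] 1, & \text{otherwise.}\end{cases}$$ -/

import Mathlib

open scoped NumberField

noncomputable section

/-- The element `a` of the field `F` is a norm from the extension `F(√b) / F`, where `F(√b)` is
the splitting field of `X ^ 2 - b` over `F` (so `F(√b) = F` when `b` is a square in `F`). -/
def IsNormFromSqrt (F : Type*) [Field F] (a b : F) : Prop :=
  ∃ z : (Polynomial.X ^ 2 - Polynomial.C b : Polynomial F).SplittingField, Algebra.norm F z = a

open Classical in
/-- The quadratic norm residue symbol `(a, b / 𝔭)` of a number field `K` at a finite prime `𝔭`,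
for nonzero `a`, `b` in `K`: it is `1` if `a` is a norm from `K_𝔭(√b) / K_𝔭`, with `K_𝔭` the
`𝔭`-adic completion of `K`, and `-1` otherwise. -/
def normResidueSymbol {K : Type*} [Field K] [NumberField K] (a b : K)
    (𝔭 : IsDedekindDomain.HeightOneSpectrum (𝓞 K)) : ℤ :=
  if IsNormFromSqrt (𝔭.adicCompletion K) (algebraMap K (𝔭.adicCompletion K) a)
      (algebraMap K (𝔭.adicCompletion K) b)
  then 1 else -1

open Classical in
/-- The rational biquadratic residue symbol `(a / p)_4`, for a prime `p ≡ 1 (mod 4)` and an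
integer `a` that is a nonzero quadratic residue modulo `p`: it is `1` if `a` is a fourth power
modulo `p`, and `-1` otherwise. -/
def rationalQuarticSymbol (a : ℤ) (p : ℕ) : ℤ :=
  if ∃ x : ZMod p, x ^ 4 = (a : ZMod p) then 1 else -1

/-- The cyclotomic unit `ζ ^ ((1 - k) / 2) * (1 - ζ ^ k) / (1 - ζ)`, for odd `k`
(so that the division of `1 - k` by `2` is exact). -/
def cycloUnit {K : Type*} [Field K] (ζ : K) (k : ℤ) : K :=
  ζ ^ ((1 - k) / 2) * ((1 - ζ ^ k) / (1 - ζ))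

end

open scoped NumberField

/-! Write `n = m + 3`. As `p` is odd, it is unramified in `K`, hence a uniformizer at `𝔭`, and the
symbol of a unit against `p` is its quadratic character in the residue field, of order `q = p ^ 2 ^
m` (`isNormFromSqrt_adicCompletion_iff`, `natCard_quotient`). Since `p ≡ 9 [MOD 16]`, `(q - 1) / 2`
is an odd multiple of `2 ^ (m + 2)`, so `ζ` has character `-1`. For the cyclotomic units, taking
norms down the tower of quadratic extensions of finite fields replaces `1 - ζ ^ k` by `1 - z ^ k`,
with `z` a primitive 8th root of unity in the prime field (`one_sub_pow_half`). Only `k` mod 8 then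
matters, and the four cases follow from `(z - z ^ 3) ^ 2 = 2`: the character of this square root of
2 is the quartic symbol of 2. -/

/-! ### Quadratic characters in the residue field -/

theorem exists_odd_pow_two_pow_eq {p : ℕ} (hp9 : p ≡ 9 [MOD 16]) (m : ℕ) :
    ∃ c, Odd c ∧ p ^ 2 ^ m = 2 * (2 ^ (m + 2) * c) + 1 := by
  induction m with
  | zero =>
    have h : p % 16 = 9 := hp9
    exact ⟨p / 8, Nat.odd_iff.2 (by lia), by lia⟩
  | succ m ih =>
    obtain ⟨c, hc, h⟩ := ih
    refine ⟨c * (2 ^ (m + 2) * c + 1), hc.mul ?_, ?_⟩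
    · exact Even.add_one ⟨2 ^ (m + 1) * c, by ring⟩
    · rw [pow_succ 2 m, pow_mul, h]
      ring

theorem IsPrimitiveRoot.pow_two_pow_mul_odd {F : Type*} [CommRing F] [IsDomain F] {ζ : F} {m c : ℕ}
    (hζ : IsPrimitiveRoot ζ (2 ^ (m + 1))) (hc : Odd c) : ζ ^ (2 ^ m * c) = -1 := by
  have h1 : IsPrimitiveRoot (ζ ^ 2 ^ m) 2 := hζ.pow (by positivity) (pow_succ 2 m)
  rw [pow_mul, h1.eq_neg_one_of_two_right, hc.neg_one_pow]

/-- The character of a quadratic extension is that of the base composed with the norm. With `σ` the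
`p ^ 2 ^ m` Frobenius, `σ ζ = -ζ`, so the norm of `1 - ζ ^ k` is `(1 - ζ ^ k) * (1 + ζ ^ k) = 1 - (ζ
^ 2) ^ k`; then induct. -/
theorem one_sub_pow_half {F : Type*} [Field F] {p : ℕ} [Fact p.Prime] [CharP F p]
    (hp9 : p ≡ 9 [MOD 16]) {m k : ℕ} (hk : Odd k) {ζ : F}
    (hζ : IsPrimitiveRoot ζ (2 ^ (m + 3))) :
    (1 - ζ ^ k) ^ (p ^ 2 ^ m / 2) = (1 - (ζ ^ 2 ^ m) ^ k) ^ (p / 2) := by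
  induction m generalizing ζ with
  | zero => simp
  | succ m ih =>
    obtain ⟨c, hc, h⟩ := exists_odd_pow_two_pow_eq hp9 m
    have hζ2 : IsPrimitiveRoot (ζ ^ 2) (2 ^ (m + 3)) := hζ.pow (by positivity) (by ring)
    have hfrob : (1 - ζ ^ k) ^ p ^ 2 ^ m = 1 + ζ ^ k := by
      have h2 : ζ ^ p ^ 2 ^ m = -ζ := by
        rw [h, pow_succ, ← mul_assoc, ← pow_succ' 2, hζ.pow_two_pow_mul_odd hc]
        ring
      rw [sub_pow_char_pow, ← pow_mul, mul_comm, pow_mul, h2, hk.neg_pow, one_pow, sub_neg_eq_add]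
    have hdiv : p ^ 2 ^ (m + 1) / 2 = (p ^ 2 ^ m + 1) * (p ^ 2 ^ m / 2) := by
      have h3 : p ^ 2 ^ (m + 1) = 2 * ((p ^ 2 ^ m + 1) * (2 ^ (m + 2) * c)) + 1 := by
        rw [pow_succ 2 m, pow_mul, h]; ring
      have h4 : p ^ 2 ^ m / 2 = 2 ^ (m + 2) * c := by lia
      rw [h4]; lia
    rw [hdiv, pow_mul, pow_succ, hfrob, pow_succ' 2 m, pow_mul ζ 2, ← ih hζ2]
    ring

theorem two_pow_quarter_eq_rationalQuarticSymbol {p : ℕ} [Fact p.Prime] (hp9 : p ≡ 9 [MOD 16])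
    (F : Type*) [Field F] [CharP F p] :
    (2 : F) ^ (p / 4) = rationalQuarticSymbol 2 p := by
  have hmod : p % 16 = 9 := hp9
  have h2 : (2 : ZMod p) ≠ 0 := by
    intro h
    have := (ZMod.natCast_eq_zero_iff 2 p).1 (by exact_mod_cast h)
    have := Nat.le_of_dvd (by norm_num) this
    interval_cases p <;> lia
  obtain ⟨s, hs⟩ := (ZMod.exists_sq_eq_two_iff (p := p) (by lia)).2 (by lia)
  have hs0 : s ≠ 0 := by rintro rfl; simp_all
  -- Both sides are the quadratic character of a square root `s` of 2; if `s` is a square, then 2 is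
  -- a fourth power.
  have hq : (2 : ZMod p) ^ (p / 4) = s ^ (p / 2) := by
    rw [hs, ← pow_two, ← pow_mul]; congr 1; lia
  have key : (2 : ZMod p) ^ (p / 4) = rationalQuarticSymbol 2 p := by
    unfold rationalQuarticSymbol
    split_ifs with h
    · obtain ⟨x, hx⟩ := h
      have hx0 : x ≠ 0 := by rintro rfl; exact h2 (by simpa using hx.symm)
      rw [show (2 : ZMod p) = x ^ 4 by simpa using hx.symm, ← pow_mul,
        show 4 * (p / 4) = p - 1 by lia, ZMod.pow_card_sub_one_eq_one hx0]
      simp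
    · rcases ZMod.pow_div_two_eq_neg_one_or_one p hs0 with h1 | h1
      · obtain ⟨y, hy⟩ := (ZMod.euler_criterion p hs0).2 h1
        refine absurd ⟨y, ?_⟩ h
        simp only [Int.cast_ofNat]
        rw [hs, hy]; ring
      · rw [hq, h1]; simp
  simpa only [map_pow, map_ofNat, map_intCast] using congrArg (ZMod.castHom dvd_rfl F) key

/-- The quadratic character of the reduction `a` of the cyclotomic unit with `k = 2 * j + 1`. -/
theorem reduction_cycloUnit_pow_half {F : Type*} [Field F] {p : ℕ} [Fact p.Prime] [CharP F p]
    (hp9 : p ≡ 9 [MOD 16]) {m j : ℕ} {ζ a : F} (hζ : IsPrimitiveRoot ζ (2 ^ (m + 3)))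
    (ha : ζ ^ j * (1 - ζ) * a = 1 - ζ ^ (2 * j + 1)) :
    a ^ (p ^ 2 ^ m / 2) =
      if j % 4 = 1 ∨ j % 4 = 2 then -(rationalQuarticSymbol 2 p : F) else 1 := by
  have hmod : p % 16 = 9 := hp9
  obtain ⟨c, hc, h⟩ := exists_odd_pow_two_pow_eq hp9 m
  set E := p ^ 2 ^ m / 2 with hE
  have hζE : ζ ^ E = -1 := by
    rw [show E = 2 ^ (m + 2) * c by lia]
    exact hζ.pow_two_pow_mul_odd hc
  have hu := one_sub_pow_half hp9 (k := 2 * j + 1) (by simp) hζ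
  have hv := one_sub_pow_half hp9 (k := 1) (by simp) hζ
  set z := ζ ^ 2 ^ m with hzdef
  have hz : IsPrimitiveRoot z (2 ^ (2 + 1)) := hζ.pow (by positivity) (by ring)
  have hz4 : z ^ 4 = -1 := hz.pow_two_pow_mul_odd (c := 1) odd_one
  set e := p / 2 with he
  have hze : z ^ e = -1 := by
    rw [show e = 2 ^ 2 * (p / 8) by lia]
    exact hz.pow_two_pow_mul_odd (Nat.odd_iff.2 (by lia))
  have hzp : z ^ p = z := by
    rw [show p = e + e + 1 by lia, pow_succ, pow_add, hze]; ring
  have hz1 : 1 - z ≠ 0 := by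
    intro h0
    rw [← sub_eq_zero.1 h0] at hz
    exact absurd hz.eq_orderOf (by simp)
  have hz1' : 1 + z ≠ 0 := by
    intro h0
    have : z = -1 := by linear_combination h0
    rw [this] at hz hz4
    have := hz.pow_eq_one_iff_dvd 2
    simp at this
  have hne1 : (1 - z) ^ e ≠ 0 := pow_ne_zero _ hz1
  have hm1 : (1 - z) ^ e * (1 - z) ^ e = 1 := by
    have : (1 - z) ^ p = 1 - z := by rw [sub_pow_char, one_pow, hzp]
    rw [show p = e + e + 1 by lia, pow_succ, pow_add] at this
    exact mul_right_cancel₀ hz1 (by rw [this, one_mul])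
  have hp1 : (1 + z) ^ e * (1 + z) ^ e = 1 := by
    have : (1 + z) ^ p = 1 + z := by rw [add_pow_char, one_pow, hzp]
    rw [show p = e + e + 1 by lia, pow_succ, pow_add] at this
    exact mul_right_cancel₀ hz1' (by rw [this, one_mul])
  -- `z - z ^ 3` is a square root of 2, because `z ^ 4 = -1`.
  have hs : (z - z ^ 3) ^ e = rationalQuarticSymbol 2 p := by
    rw [← two_pow_quarter_eq_rationalQuarticSymbol hp9 F, show e = 2 * (p / 4) by lia, pow_mul]
    congr 1
    linear_combination (z ^ 2 - 2) * hz4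
  have hq : (rationalQuarticSymbol 2 p : F) * rationalQuarticSymbol 2 p = 1 := by
    unfold rationalQuarticSymbol; split_ifs <;> simp
  set q : F := (rationalQuarticSymbol 2 p : F)
  have main : (-1) ^ j * (1 - z) ^ e * a ^ E = (1 - z ^ (2 * j + 1)) ^ e := by
    rw [← hu, ← ha, mul_pow, mul_pow, ← pow_mul, mul_comm j, pow_mul, hζE]
    simp only [pow_one] at hv
    rw [hv]
  obtain ⟨i, r, hr, rfl⟩ : ∃ i r, r < 4 ∧ j = 4 * i + r := ⟨j / 4, j % 4, by lia, by lia⟩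
  have hz8 : z ^ (2 * (4 * i + r) + 1) = z ^ (2 * r + 1) := by
    rw [show 2 * (4 * i + r) + 1 = 4 * (2 * i) + (2 * r + 1) by ring, pow_add, pow_mul, hz4,
      pow_mul]
    simp
  have hneg : (-1 : F) ^ (4 * i + r) = (-1) ^ r := by
    rw [pow_add, show 4 * i = 2 * (2 * i) by ring, pow_mul]; simp
  rw [hz8, hneg] at main
  rw [show (4 * i + r) % 4 = r by lia]
  apply mul_left_cancel₀ hne1
  -- The cases are `k ≡ 1, 3, 5, 7` mod 8. Each compares `1 - z ^ k` with `1 - z` up to squares,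
  -- powers of `z` and `z - z ^ 3`.
  interval_cases r
  · simpa using main
  · have h1 : (1 - z ^ 3) ^ e * q = (1 - z) ^ e := by
      rw [← hs, ← mul_pow,
        show (1 - z ^ 3) * (z - z ^ 3) = (1 - z) * ((1 + z) * (1 + z)) by
          linear_combination (z ^ 2 - 1) * hz4, mul_pow, mul_pow, hp1, mul_one]
    norm_num at main ⊢
    linear_combination (-1) * main - q * h1 + (1 - z ^ 3) ^ e * hq
  · have h1 : (1 - z) ^ e * (1 + z) ^ e = -q := by
      have : z ^ e * ((1 - z) ^ e * (1 + z) ^ e) = q := by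
        rw [← hs, ← mul_pow, ← mul_pow]; ring
      rw [hze] at this
      linear_combination -this
    have h5 : z ^ 5 = -z := by linear_combination z * hz4
    norm_num [h5] at main ⊢
    linear_combination main + (1 - z) ^ e * h1 - (1 + z) ^ e * hm1
  · have h1 : (1 - z ^ 7) ^ e = - (1 - z) ^ e := by
      rw [show 1 - z ^ 7 = z ^ 3 * (1 - z) by linear_combination (- z ^ 3 + 1) * hz4, mul_pow,
        ← pow_mul, mul_comm 3, pow_mul, hze]
      ring
    norm_num [h1] at main ⊢
    linear_combination main

/-! ### Local norms and the tame symbol -/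

/-- The splitting field is identified with `QuadraticAlgebra F b 0`, whose norm form is explicit. -/
theorem isNormFromSqrt_iff {F : Type*} [Field F] (h2 : (2 : F) ≠ 0) {a b : F} (hb : ¬ IsSquare b) :
    IsNormFromSqrt F a b ↔ ∃ x y : F, a = x ^ 2 - b * y ^ 2 := by
  have : Fact (∀ r : F, r ^ 2 ≠ b + 0 * r) :=
    ⟨fun r hr ↦ hb ⟨r, by rw [← pow_two, hr]; ring⟩⟩
  have hirr : Irreducible (Polynomial.X ^ 2 - Polynomial.C b : Polynomial F) :=
    X_pow_sub_C_irreducible_of_prime Nat.prime_two fun r hr ↦ hb ⟨r, by rw [← hr, pow_two]⟩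
  set S := (Polynomial.X ^ 2 - Polynomial.C b : Polynomial F).SplittingField
  obtain ⟨s, hs⟩ : ∃ s : S, s ^ 2 = algebraMap F S b := by
    obtain ⟨s, hs⟩ := (Polynomial.SplittingField.splits
      (Polynomial.X ^ 2 - Polynomial.C b : Polynomial F)).exists_eval_eq_zero (by
        rw [Polynomial.degree_map, Polynomial.degree_X_pow_sub_C (by norm_num)]; norm_num)
    exact ⟨s, sub_eq_zero.1 (by simpa using hs)⟩
  let f : QuadraticAlgebra F b 0 →ₐ[F] S :=
    QuadraticAlgebra.lift ⟨s, by rw [← pow_two, hs, Algebra.algebraMap_eq_smul_one]; simp⟩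
  have hfin : Module.finrank F S = 2 := by
    refine finrank_of_isSplittingField_X_pow_sub_C ⟨-1, ?_⟩ hirr S
    rw [mem_primitiveRoots two_pos, IsPrimitiveRoot.iff_def]
    refine ⟨by simp, fun l hl ↦ even_iff_two_dvd.1 (by_contra fun hodd ↦ h2 ?_)⟩
    rw [(Nat.not_even_iff_odd.1 hodd).neg_one_pow] at hl
    linear_combination -hl
  have : FiniteDimensional F S := inferInstance
  have hf : Function.Bijective f :=
    ⟨f.toRingHom.injective, (LinearMap.injective_iff_surjective_of_finrank_eq_finrank
      (f := f.toLinearMap) (by rw [hfin, QuadraticAlgebra.finrank_eq_two])).1 f.toRingHom.injective⟩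
  have hnorm (w : QuadraticAlgebra F b 0) : Algebra.norm F (f w) = w.re ^ 2 - b * w.im ^ 2 := by
    rw [show f w = AlgEquiv.ofBijective f hf w from rfl, Algebra.norm_eq_of_algEquiv,
      Algebra.norm_apply]
    refine (congrArg LinearMap.det (LinearMap.ext fun _ ↦ rfl)).trans
      ((QuadraticAlgebra.det_toLinearMap_eq_norm w).trans ?_)
    rw [QuadraticAlgebra.norm_def]
    ring
  constructor
  · rintro ⟨z, rfl⟩
    obtain ⟨w, rfl⟩ := hf.2 z
    exact ⟨w.re, w.im, hnorm w⟩
  · rintro ⟨x, y, rfl⟩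
    exact ⟨f ⟨x, y⟩, hnorm _⟩

/-- Hensel's lemma for squares: `(x + t) ^ 2 = a` means that `t` is fixed by `t ↦ (c - t ^ 2) / (2 *
x)`, a contraction of the closed ball of radius `‖c‖`. -/
theorem isSquare_of_norm_sub_sq_lt_one {F : Type*} [NormedField F] [IsUltrametricDist F]
    [CompleteSpace F] (h2 : ‖(2 : F)‖ = 1) {a x : F} (hx : ‖x‖ = 1) (hax : ‖a - x ^ 2‖ < 1) :
    IsSquare a := by
  set c := a - x ^ 2 with hc
  let s : Set F := Metric.closedBall 0 ‖c‖
  let f : F → F := fun t ↦ (c - t ^ 2) / (2 * x)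
  have h2x : 2 * x ≠ 0 := by
    rw [← norm_ne_zero_iff, norm_mul, h2, hx]; norm_num
  have hs {t : F} : t ∈ s ↔ ‖t‖ ≤ ‖c‖ := mem_closedBall_zero_iff
  have hsf : Set.MapsTo f s s := by
    intro t ht
    rw [hs] at ht ⊢
    simp only [f, norm_div, norm_mul, h2, hx, mul_one, div_one]
    rw [sub_eq_add_neg]
    refine (IsUltrametricDist.norm_add_le_max _ _).trans (max_le le_rfl ?_)
    rw [norm_neg, norm_pow]
    nlinarith [norm_nonneg t]
  have hf : ContractingWith ‖c‖₊ (hsf.restrict f s s) := by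
    refine ⟨hax, LipschitzWith.of_dist_le_mul fun t u ↦ ?_⟩
    have ht := hs.1 t.2
    have hu := hs.1 u.2
    rw [Subtype.dist_eq, Subtype.dist_eq, dist_eq_norm, dist_eq_norm]
    simp only [Set.MapsTo.val_restrict_apply, f, coe_nnnorm]
    rw [← sub_div, show c - (t : F) ^ 2 - (c - (u : F) ^ 2) = (u + t) * (u - t) by ring,
      norm_div, norm_mul, norm_mul 2, h2, hx, mul_one, div_one, norm_sub_rev]
    gcongr
    exact (IsUltrametricDist.norm_add_le_max _ _).trans (max_le hu ht)
  obtain ⟨t, -, ht, -⟩ := hf.exists_fixedPoint' Metric.isClosed_closedBall.isComplete hsf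
    (x := 0) (hs.2 (by simp)) (edist_ne_top _ _)
  have ht : (c - t ^ 2) / (2 * x) = t := ht
  rw [div_eq_iff h2x] at ht
  exact ⟨x + t, by linear_combination ht - hc⟩

/-- Parity: one side has odd valuation, the other even. -/
theorem WithZero.exp_neg_one_mul_sq_ne_sq {g h : WithZero (Multiplicative ℤ)} (hh : h ≠ 0) :
    WithZero.exp (-1 : ℤ) * g ^ 2 ≠ h ^ 2 := by
  intro H
  have hg : g ≠ 0 := by
    rintro rfl
    exact pow_ne_zero 2 hh (by simpa using H.symm)
  have := congrArg WithZero.log H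
  rw [WithZero.log_mul WithZero.exp_ne_zero (pow_ne_zero 2 hg), WithZero.log_pow,
    WithZero.log_pow, WithZero.log_exp] at this
  simp only [nsmul_eq_mul] at this
  lia

open IsDedekindDomain HeightOneSpectrum

/-- Completing does not enlarge the residue field: approximate first by `K`, then by `𝓞 K`. -/
theorem exists_valued_sub_lt_one {K : Type*} [Field K] [NumberField K]
    (v : HeightOneSpectrum (𝓞 K)) {x : v.adicCompletion K} (hx : Valued.v x ≤ 1) :
    ∃ r : 𝓞 K, Valued.v (x - algebraMap K _ (r : K)) < 1 := by
  have hnhds : {y : v.adicCompletion K | Valued.v (y - x) < 1} ∈ nhds x := by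
    rw [Valued.mem_nhds]
    exact ⟨1, by simp⟩
  obtain ⟨-, ⟨y, rfl⟩, hy⟩ := (denseRange_algebraMap K v).inter_nhds_nonempty hnhds
  have hy : Valued.v (algebraMap K _ y - x) < 1 := hy
  have hvy : v.valuation K y ≤ 1 := by
    rw [← valuedAdicCompletion_eq_valuation' v y]
    exact (Valuation.map_add_le _ hy.le hx).trans_eq' (by rw [sub_add_cancel]; rfl)
  obtain ⟨r, hr⟩ := exists_valuation_sub_lt_of_integer v hvy 1
  rw [← valuedAdicCompletion_eq_valuation' v] at hr
  have hr : Valued.v (algebraMap K (v.adicCompletion K) ((r : K) - y)) < 1 := hr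
  refine ⟨r, ?_⟩
  rw [Valuation.map_sub_swap, show algebraMap K (v.adicCompletion K) (r : K) - x =
    algebraMap K _ ((r : K) - y) + (algebraMap K _ y - x) by rw [map_sub]; ring]
  exact Valuation.map_add_lt _ hr hy

theorem isNormFromSqrt_adicCompletion_iff {K : Type*} [Field K] [NumberField K]
    (v : HeightOneSpectrum (𝓞 K)) {a π : 𝓞 K} (h2 : (2 : 𝓞 K) ∉ v.asIdeal)
    (ha : a ∉ v.asIdeal) (hπ : π ∈ v.asIdeal) (hπ2 : π ∉ v.asIdeal ^ 2) :
    IsNormFromSqrt (v.adicCompletion K) (algebraMap K _ (a : K)) (algebraMap K _ (π : K)) ↔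
      ∃ r, a - r ^ 2 ∈ v.asIdeal := by
  have hval (r : 𝓞 K) : Valued.v (algebraMap K (v.adicCompletion K) (r : K)) =
      v.intValuation r := by
    rw [← valuation_of_algebraMap (K := K)]
    exact valuedAdicCompletion_eq_valuation' v (r : K)
  have : IsUltrametricDist (v.adicCompletion K) := by
    open scoped Valued in exact inferInstance
  have hlt (y : v.adicCompletion K) : ‖y‖ < 1 ↔ Valued.v y < 1 :=
    Valued.toNormedField.norm_lt_one_iff
  have hle (y : v.adicCompletion K) : ‖y‖ ≤ 1 ↔ Valued.v y ≤ 1 :=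
    Valued.toNormedField.norm_le_one_iff
  have hnorm {y : v.adicCompletion K} (hy : Valued.v y = 1) : ‖y‖ = 1 :=
    le_antisymm ((hle y).2 hy.le) (not_lt.1 fun h ↦ ((hlt y).1 h).ne hy)
  have hva : Valued.v (algebraMap K (v.adicCompletion K) (a : K)) = 1 := by
    rw [hval, intValuation_eq_one_iff.2 ha]
  have hv2 : Valued.v (2 : v.adicCompletion K) = 1 := by
    rw [← intValuation_eq_one_iff.2 h2, ← hval]
    exact congrArg _
      (map_ofNat ((algebraMap K (v.adicCompletion K)).comp (algebraMap (𝓞 K) K)) 2).symm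
  have hvπ : Valued.v (algebraMap K (v.adicCompletion K) (π : K)) = WithZero.exp (-1 : ℤ) := by
    rw [hval]
    refine le_antisymm ?_ ?_
    · simpa using (v.intValuation_le_pow_iff_mem π 1).2 (by simpa using hπ)
    · have := mt (v.intValuation_le_pow_iff_mem π 2).1 hπ2
      rw [not_le] at this
      have h0 : v.intValuation π ≠ 0 := ne_zero_of_lt this
      rw [← WithZero.exp_log h0, WithZero.exp_lt_exp] at this
      rw [← WithZero.exp_log h0, WithZero.exp_le_exp]
      push_cast at this
      lia
  have hπsq : ¬ IsSquare (algebraMap K (v.adicCompletion K) (π : K)) := by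
    rintro ⟨r, hr⟩
    have hr0 : r ≠ 0 := by
      rintro rfl
      rw [hr, mul_zero, map_zero] at hvπ
      exact WithZero.exp_ne_zero hvπ.symm
    refine WithZero.exp_neg_one_mul_sq_ne_sq (g := 1) ((Valued.v.ne_zero_iff).2 hr0) ?_
    rw [← hvπ, hr, map_mul, one_pow, mul_one, pow_two]
  rw [isNormFromSqrt_iff (fun h ↦ by simp [h] at hv2) hπsq]
  constructor
  · rintro ⟨x, y, hxy⟩
    have hπy : Valued.v (algebraMap K (v.adicCompletion K) (π : K) * y ^ 2) =
      WithZero.exp (-1 : ℤ) * Valued.v y ^ 2 := by rw [map_mul, map_pow, hvπ]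
    have hπy1 : WithZero.exp (-1 : ℤ) * Valued.v y ^ 2 ≠ 1 := by
      simpa using WithZero.exp_neg_one_mul_sq_ne_sq (g := Valued.v y) one_ne_zero
    -- `x ^ 2` and `π * y ^ 2` have different valuations, so the larger one is that of the unit `a`;
    -- by parity it must be `x ^ 2`. Hence `a ≡ x ^ 2` modulo the maximal ideal.
    have hvx : Valued.v x = 1 ∧ WithZero.exp (-1 : ℤ) * Valued.v y ^ 2 < 1 := by
      rw [hxy] at hva
      by_cases hx : x = 0
      · subst hx
        rw [zero_pow two_ne_zero, zero_sub, Valuation.map_neg, hπy] at hva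
        exact absurd hva hπy1
      · have hne := WithZero.exp_neg_one_mul_sq_ne_sq (g := Valued.v y)
          ((Valued.v.ne_zero_iff).2 hx)
        rcases lt_or_gt_of_ne hne with h | h
        · rw [Valuation.map_sub_eq_of_lt_left _ (by rwa [hπy, map_pow]), map_pow] at hva
          exact ⟨(pow_eq_one_iff_of_nonneg zero_le two_ne_zero).1 hva, hva ▸ h⟩
        · rw [Valuation.map_sub_eq_of_lt_right _ (by rwa [hπy, map_pow]), hπy] at hva
          exact absurd hva hπy1
    obtain ⟨r, hr⟩ := exists_valued_sub_lt_one v hvx.1.le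
    refine ⟨r, (intValuation_lt_one_iff_mem v _).1 ?_⟩
    rw [← hval, show algebraMap K (v.adicCompletion K) ((a - r ^ 2 : 𝓞 K) : K) =
      (x - algebraMap K _ (r : K)) * (x + algebraMap K _ (r : K)) -
        algebraMap K _ (π : K) * y ^ 2 by
          simp only [map_sub, map_pow, hxy]; ring]
    refine Valuation.map_sub_lt _ ?_ (by rw [hπy]; exact hvx.2)
    rw [map_mul]
    refine mul_lt_one_of_lt_of_le hr (Valuation.map_add_le _ hvx.1.le ?_)
    rw [hval]
    exact intValuation_le_one v r
  · rintro ⟨r, hr⟩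
    have hr' : r ∉ v.asIdeal := fun h ↦ ha (by
      simpa using v.asIdeal.add_mem hr (v.asIdeal.pow_mem_of_mem h 2 two_pos))
    obtain ⟨z, hz⟩ := isSquare_of_norm_sub_sq_lt_one (a := algebraMap K (v.adicCompletion K) a)
      (hnorm hv2)
      (hnorm (y := algebraMap K (v.adicCompletion K) (r : K))
        (by rw [hval, intValuation_eq_one_iff.2 hr']))
      ((hlt _).2 (by
        rw [← map_pow, ← map_sub, ← map_pow, ← map_sub, hval]
        exact (intValuation_lt_one_iff_mem v _).2 hr))
    exact ⟨z, 0, by rw [hz]; ring⟩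

/-! ### Ramification and residue degree of `p` -/

theorem orderOf_cast_zmod_two_pow {p : ℕ} (hp9 : p ≡ 9 [MOD 16]) (m : ℕ) :
    orderOf (p : ZMod (2 ^ (m + 3))) = 2 ^ m := by
  have key (i : ℕ) : (p : ZMod (2 ^ (m + 3))) ^ 2 ^ i = 1 ↔ m ≤ i := by
    obtain ⟨c, hc, h⟩ := exists_odd_pow_two_pow_eq hp9 i
    rw [← Nat.cast_pow, h, Nat.cast_add, Nat.cast_one, add_eq_right, ZMod.natCast_eq_zero_iff,
      ← mul_assoc, ← pow_succ',
      Nat.Coprime.dvd_mul_right (Nat.Coprime.pow_left _ hc.coprime_two_left),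
      Nat.pow_dvd_pow_iff_le_right (by norm_num)]
    lia
  cases m with
  | zero => exact orderOf_eq_one_iff.2 (by simpa using (key 0).2 le_rfl)
  | succ m =>
    exact orderOf_eq_prime_pow (by rw [key]; lia) ((key _).2 le_rfl)

theorem liesOver_span_of_mem {K : Type*} [Field K] {p : ℕ} (𝔭 : HeightOneSpectrum (𝓞 K))
    (hp : p.Prime) (h𝔭 : (p : 𝓞 K) ∈ 𝔭.asIdeal) :
    𝔭.asIdeal.LiesOver (Ideal.span {(p : ℤ)}) := by
  have : (Ideal.span {(p : ℤ)}).IsMaximal :=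
    PrincipalIdealRing.isMaximal_of_irreducible (Nat.prime_iff_prime_int.1 hp).irreducible
  refine ⟨this.eq_of_le ?_ ?_⟩
  · exact (inferInstance : (𝔭.asIdeal.under ℤ).IsPrime).ne_top
  · rw [Ideal.span_singleton_le_iff_mem, Ideal.mem_under]
    simpa using h𝔭

theorem charP_quotient {K : Type*} [Field K] {p : ℕ} (𝔭 : HeightOneSpectrum (𝓞 K))
    (hp : p.Prime) (h𝔭 : (p : 𝓞 K) ∈ 𝔭.asIdeal) :
    CharP (𝓞 K ⧸ 𝔭.asIdeal) p :=
  ringChar.of_eq (((Nat.dvd_prime hp).1 (ringChar.dvd (by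
    rw [← map_natCast (Ideal.Quotient.mk 𝔭.asIdeal)]
    exact Ideal.Quotient.eq_zero_iff_mem.2 h𝔭))).resolve_left CharP.ringChar_ne_one)

theorem natCast_notMem_sq {K : Type*} [Field K] {m : ℕ} [NumberField K]
    [IsCyclotomicExtension {2 ^ (m + 3)} ℚ K] {p : ℕ} (𝔭 : HeightOneSpectrum (𝓞 K))
    (hp : p.Prime) (hp2 : p ≠ 2) (h𝔭 : (p : 𝓞 K) ∈ 𝔭.asIdeal) :
    (p : 𝓞 K) ∉ 𝔭.asIdeal ^ 2 := by
  have := Fact.mk hp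
  have := liesOver_span_of_mem 𝔭 hp h𝔭
  have hram := IsCyclotomicExtension.Rat.ramificationIdx_eq_of_not_dvd (m := 2 ^ (m + 3)) p K
    𝔭.asIdeal (fun h ↦ hp2 ((Nat.prime_dvd_prime_iff_eq hp Nat.prime_two).1 (hp.dvd_of_dvd_pow h)))
  rw [← Ideal.ramificationIdx'_eq_ramificationIdx (Ideal.span {(p : ℤ)}) _
    (by simpa using hp.ne_zero)] at hram
  have hmap : (Ideal.span {(p : ℤ)}).map (algebraMap ℤ (𝓞 K)) = Ideal.span {(p : 𝓞 K)} := by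
    rw [Ideal.map_span]; simp
  have := mt (Ideal.ramificationIdx'_ne_one_iff (P := 𝔭.asIdeal)
    (p := Ideal.span {(p : ℤ)})
    (by rwa [hmap, Ideal.span_singleton_le_iff_mem])).2 (not_not.2 hram)
  rwa [hmap, Ideal.span_singleton_le_iff_mem] at this

theorem natCard_quotient {K : Type*} [Field K] {m : ℕ} [NumberField K]
    [IsCyclotomicExtension {2 ^ (m + 3)} ℚ K] {p : ℕ} (𝔭 : HeightOneSpectrum (𝓞 K))
    (hp : p.Prime) (hp9 : p ≡ 9 [MOD 16]) (h𝔭 : (p : 𝓞 K) ∈ 𝔭.asIdeal) :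
    Nat.card (𝓞 K ⧸ 𝔭.asIdeal) = p ^ 2 ^ m := by
  have := Fact.mk hp
  have := liesOver_span_of_mem 𝔭 hp h𝔭
  have hp2 : p ≠ 2 := by rintro rfl; exact absurd hp9 (by decide)
  have hin := IsCyclotomicExtension.Rat.inertiaDeg_eq_of_not_dvd (m := 2 ^ (m + 3)) p K
    𝔭.asIdeal (fun h ↦ hp2 ((Nat.prime_dvd_prime_iff_eq hp Nat.prime_two).1 (hp.dvd_of_dvd_pow h)))
  rw [← orderOf_cast_zmod_two_pow hp9, ← hin, Ideal.pow_inertiaDeg p]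
  rfl

/-- Euler's criterion in the residue field, combined with the tame symbol. -/
theorem normResidueSymbol_natCast_eq {K : Type*} [Field K] {m : ℕ} [NumberField K]
    [IsCyclotomicExtension {2 ^ (m + 3)} ℚ K] {p : ℕ} (𝔭 : HeightOneSpectrum (𝓞 K))
    (hp : p.Prime) (hp9 : p ≡ 9 [MOD 16])
    (h𝔭 : (p : 𝓞 K) ∈ 𝔭.asIdeal) {a : 𝓞 K} {ε : ℤ} (hε : ε = 1 ∨ ε = -1)
    (ha : Ideal.Quotient.mk 𝔭.asIdeal a ^ (p ^ 2 ^ m / 2) = ε) :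
    normResidueSymbol (a : K) (p : K) 𝔭 = ε := by
  have hmod : p % 16 = 9 := hp9
  have hp2 : p ≠ 2 := by lia
  have := Fact.mk hp
  let _ : Field (𝓞 K ⧸ 𝔭.asIdeal) := Ideal.Quotient.field _
  have hchar : CharP (𝓞 K ⧸ 𝔭.asIdeal) p := charP_quotient 𝔭 hp h𝔭
  have hcard := natCard_quotient (m := m) 𝔭 hp hp9 h𝔭
  have : Finite (𝓞 K ⧸ 𝔭.asIdeal) :=
    Nat.finite_of_card_ne_zero (by rw [hcard]; exact pow_ne_zero _ hp.ne_zero)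
  have := Fintype.ofFinite (𝓞 K ⧸ 𝔭.asIdeal)
  have h2 : (2 : 𝓞 K ⧸ 𝔭.asIdeal) ≠ 0 :=
    Ring.two_ne_zero (by rwa [ringChar.eq (𝓞 K ⧸ 𝔭.asIdeal) p])
  have h0 : Ideal.Quotient.mk 𝔭.asIdeal a ≠ 0 := by
    intro h0
    obtain ⟨c, hc, h⟩ := exists_odd_pow_two_pow_eq hp9 m
    have : p ^ 2 ^ m / 2 ≠ 0 := by
      rw [h]
      have := Nat.mul_pos (pow_pos two_pos (m + 2)) hc.pos
      lia
    rw [h0, zero_pow this] at ha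
    rcases hε with rfl | rfl <;> simp at ha
  have hsq := FiniteField.isSquare_iff (F := 𝓞 K ⧸ 𝔭.asIdeal)
    (by rwa [ringChar.eq (𝓞 K ⧸ 𝔭.asIdeal) p]) h0
  rw [Fintype.card_eq_nat_card, hcard, ha] at hsq
  have hiff := isNormFromSqrt_adicCompletion_iff 𝔭 (a := a) (π := p)
    (fun h ↦ h2 <| by
      rw [← map_ofNat (Ideal.Quotient.mk 𝔭.asIdeal)]
      exact Ideal.Quotient.eq_zero_iff_mem.2 h)
    (fun h ↦ h0 (Ideal.Quotient.eq_zero_iff_mem.2 h)) h𝔭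
    (natCast_notMem_sq (m := m) 𝔭 hp hp2 h𝔭)
  have hsq' : (∃ r, a - r ^ 2 ∈ 𝔭.asIdeal) ↔ IsSquare (Ideal.Quotient.mk 𝔭.asIdeal a) := by
    simp_rw [← Ideal.Quotient.eq, map_pow, isSquare_iff_exists_sq]
    exact ⟨fun ⟨r, hr⟩ ↦ ⟨_, hr⟩, fun ⟨r, hr⟩ ↦ by
      obtain ⟨r, rfl⟩ := Ideal.Quotient.mk_surjective r
      exact ⟨r, hr⟩⟩
  have hpK : ((p : 𝓞 K) : K) = p := map_natCast (algebraMap (𝓞 K) K) p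
  rw [hsq', hsq, hpK] at hiff
  unfold normResidueSymbol
  rcases hε with rfl | rfl
  · exact if_pos (hiff.2 Int.cast_one)
  · refine if_neg (mt hiff.1 ?_)
    intro h
    exact h2 (by push_cast at h; linear_combination -h)

theorem isPrimitiveRoot_mk {K : Type*} [Field K] {m : ℕ} (𝔭 : HeightOneSpectrum (𝓞 K))
    {ζ : 𝓞 K} (hζ : IsPrimitiveRoot ζ (2 ^ (m + 3)))
    (h2 : (2 : 𝓞 K ⧸ 𝔭.asIdeal) ≠ 0) :
    IsPrimitiveRoot (Ideal.Quotient.mk 𝔭.asIdeal ζ) (2 ^ (m + 3)) := by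
  have h1 : ζ ^ 2 ^ (m + 2) = -1 := by simpa using hζ.pow_two_pow_mul_odd (c := 1) odd_one
  rw [← orderOf_eq_prime_pow (p := 2) (n := m + 2) (x := Ideal.Quotient.mk 𝔭.asIdeal ζ) ?_ ?_]
  · exact IsPrimitiveRoot.orderOf _
  · rw [← map_pow, h1, map_neg, map_one]
    intro h
    exact h2 (by linear_combination -h)
  · rw [← map_pow, hζ.pow_eq_one, map_one]

/-- The unit is integral, being a power of `ζ` times a geometric sum; its defining relation is
cleared of denominators so that it can be reduced modulo `𝔭`. -/
theorem exists_coe_eq_cycloUnit {K : Type*} [Field K] {ζ : 𝓞 K} {N : ℕ} (hN : 1 < N)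
    (hζ : IsPrimitiveRoot ζ N) (j : ℕ) :
    ∃ u : 𝓞 K, (u : K) = cycloUnit (ζ : K) (2 * j + 1) ∧
      ζ ^ j * (1 - ζ) * u = 1 - ζ ^ (2 * j + 1) := by
  have hinv : ζ * ζ ^ (N - 1) = 1 := by
    rw [← pow_succ', Nat.sub_add_cancel hN.le, hζ.pow_eq_one]
  have hgeom := mul_neg_geom_sum ζ (2 * j + 1)
  have hu : ζ ^ j * (1 - ζ) * ((ζ ^ (N - 1)) ^ j * ∑ i ∈ Finset.range (2 * j + 1), ζ ^ i) =
      1 - ζ ^ (2 * j + 1) := by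
    rw [← hgeom]
    calc _ = (ζ * ζ ^ (N - 1)) ^ j * ((1 - ζ) * ∑ i ∈ Finset.range (2 * j + 1), ζ ^ i) := by ring
      _ = _ := by rw [hinv, one_pow, one_mul]
  refine ⟨_, ?_, hu⟩
  have hK := congrArg (algebraMap (𝓞 K) K) hu
  simp only [map_mul, map_pow, map_sub, map_one] at hK
  have hζK : IsPrimitiveRoot (ζ : K) N :=
    hζ.map_of_injective NumberField.RingOfIntegers.coe_injective
  have h0 : (ζ : K) ≠ 0 := hζK.ne_zero (by lia)
  have h1 : 1 - (ζ : K) ≠ 0 := sub_ne_zero.2 (hζK.ne_one hN).symm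
  have hexp : (1 - (2 * j + 1 : ℤ)) / 2 = -(j : ℤ) := by lia
  rw [cycloUnit, hexp, zpow_neg, zpow_natCast,
    show (2 * j + 1 : ℤ) = (2 * j + 1 : ℕ) by push_cast; rfl,
    zpow_natCast, ← hK]
  simp only [map_mul, map_pow]
  field_simp

theorem mainTheorem4 (n : ℕ) (hn : 3 ≤ n)
    (K : Type*) [Field K] [NumberField K] [IsCyclotomicExtension {2 ^ n} ℚ K]
    (ζ : K) (hζ : IsPrimitiveRoot ζ (2 ^ n))
    (p : ℕ) (hp : p.Prime) (hp9 : p ≡ 9 [MOD 16])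
    (𝔭 : IsDedekindDomain.HeightOneSpectrum (𝓞 K)) (h𝔭 : (p : 𝓞 K) ∈ 𝔭.asIdeal) :
    normResidueSymbol ζ (p : K) 𝔭 = -1 ∧
    ∀ k : ℤ, Odd k → 1 < k → k < 2 ^ (n - 1) →
      ((k ≡ 3 [ZMOD 8] ∨ k ≡ -3 [ZMOD 8]) →
        normResidueSymbol (cycloUnit ζ k) (p : K) 𝔭 = -rationalQuarticSymbol 2 p) ∧
      (¬(k ≡ 3 [ZMOD 8] ∨ k ≡ -3 [ZMOD 8]) →
        normResidueSymbol (cycloUnit ζ k) (p : K) 𝔭 = 1) := by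
  obtain ⟨m, rfl⟩ := Nat.exists_eq_add_of_le' hn
  have hmod : p % 16 = 9 := hp9
  have := Fact.mk hp
  let _ : Field (𝓞 K ⧸ 𝔭.asIdeal) := Ideal.Quotient.field _
  have hchar : CharP (𝓞 K ⧸ 𝔭.asIdeal) p := charP_quotient 𝔭 hp h𝔭
  have h2 : (2 : 𝓞 K ⧸ 𝔭.asIdeal) ≠ 0 :=
    Ring.two_ne_zero (by rw [ringChar.eq (𝓞 K ⧸ 𝔭.asIdeal) p]; lia)
  have hζ' := hζ.toInteger_isPrimitiveRoot
  have hζp := isPrimitiveRoot_mk 𝔭 hζ' h2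
  refine ⟨?_, fun k hk hk1 _ ↦ ?_⟩
  · obtain ⟨c, hc, h⟩ := exists_odd_pow_two_pow_eq hp9 m
    refine normResidueSymbol_natCast_eq (m := m) 𝔭 hp hp9 h𝔭 (a := hζ.toInteger) (.inr rfl) ?_
    rw [show p ^ 2 ^ m / 2 = 2 ^ (m + 2) * c by lia, hζp.pow_two_pow_mul_odd hc]
    simp
  · obtain ⟨j, rfl⟩ : ∃ j : ℕ, k = 2 * j + 1 := by
      obtain ⟨j, rfl⟩ := hk
      exact ⟨j.toNat, by lia⟩
    obtain ⟨u, huK, hu⟩ := exists_coe_eq_cycloUnit (Nat.one_lt_two_pow (by lia)) hζ' j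
    have huK : (u : K) = cycloUnit ζ (2 * j + 1) := huK
    have hpow := reduction_cycloUnit_pow_half hp9 (j := j) (a := Ideal.Quotient.mk 𝔭.asIdeal u) hζp
      (by rw [← map_one (Ideal.Quotient.mk 𝔭.asIdeal), ← map_pow, ← map_pow, ← map_sub, ← map_sub,
        ← map_mul, ← map_mul, hu])
    have hiff : (2 * (j : ℤ) + 1 ≡ 3 [ZMOD 8] ∨ 2 * (j : ℤ) + 1 ≡ -3 [ZMOD 8]) ↔
        (j % 4 = 1 ∨ j % 4 = 2) := by
      unfold Int.ModEq; lia
    rw [hiff, ← huK]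
    refine ⟨fun h ↦ ?_, fun h ↦ ?_⟩
    · refine normResidueSymbol_natCast_eq (m := m) 𝔭 hp hp9 h𝔭 ?_ (by rw [hpow, if_pos h]; simp)
      unfold rationalQuarticSymbol
      split_ifs <;> simp
    · exact normResidueSymbol_natCast_eq (m := m) 𝔭 hp hp9 h𝔭 (.inl rfl)
        (by rw [hpow, if_neg h]; simp)
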